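/- Consider $N$ links in slotted time $t\in\{0,1,2,\dots\}$ and a finite collection $\mathcal S$ of feasible schedules $\mathbf S=(S_n)_{n=1}^N\in\{0,1\}^N$. In slot $t$, link $n$ offers a reward $X_n(t)\in[0,1]$, where $(X_n(t))_{t\ge 0}$ is i.i.d. with mean $\mu_n$, and has an ON-OFF channel state $C_n(t)\in\{0,1\}$, where $(C_n(t))_{t\ge0}$ is i.i.d. with $\Pr\{C_n(t)=1\}>0$. The schedule of slot $t$ is chosen on the basis of information, nondecreasing in $t$, that includes the rewards of the slots before $t$ and the channel states up to and including slot $t$ (and possibly private randomization), and the reward vector $(X_n(t))_{n=1}^N$ is independent of this information. For schedules $\widehat{\mathbf S}(t)=(\widehat S_n(t))_{n=1}^N$, let the ages satisfy $Z_n(t+1)=1$ if $C_n(t)\widehat S_n(t)=1$ and $Z_n(t+1)=Z_n(t)+1$ otherwise. Let $H_n(t)=\sum_{\tau=0}^{t-1}C_n(\tau)\widehat S_n(\tau)$, let $\overline\mu_n(t)=\frac{1}{H_n(t)}\sum_{\tau=0}^{t-1}X_n(\tau)C_n(\tau)\widehat S_n(\tau)$, and let $w_n(t)=\min\bigl\{\overline\mu_n(t)+\sqrt{3\log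 t/(2H_n(t))},\,1\bigr\}$, with $\overline\mu_n(t)=w_n(t)=1$ if $H_n(t)=0$. The LAES (Learning-based Age-Efficient Scheduling) algorithm with parameter $\eta$ selects in each slot $t$ a schedule $$\widehat{\mathbf S}(t)\in\arg\max_{\mathbf S\in\mathcal S}\sum_{n=1}^N\bigl(Z_n(t)+\eta w_n(t)\bigr)C_n(t)S_n ,$$ with ties broken in any way allowed by the available information. Let $\mathbf S^*(t)\in\arg\max_{\mathbf S\in\mathcal S}\sum_{n=1}^N\mu_nC_n(t)S_n$, and define the cumulative regret $$\mathrm{Reg}(T)=\sum_{t=0}^{T-1}\sum_{n=1}^N\Bigl(\mathbb E\bigl[\mu_nC_n(t)S_n^*(t)\bigr]-\mathbb E\bigl[\mu_nC_n(t)\widehat S_n(t)\bigr]\Bigr).$$ If $Z_n(0)=0$ for all $n$, then under the LAES algorithm with any $\eta>0$, for every integer $T>0$, $$\mathrm{Reg}(T)\le\frac{NT}{\eta}+2\sqrt{6N\,|\mathbf S|_{\max}\,T\log T}+N\Bigl(1+\frac{5\pi^2}{12}\Bigr),$$ where $|\mathbf S|_{\max}=\max_{\mathbf S\in\mathcal S}\sum_{n=1}^N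 S_n$ is the maximum number of links that can be scheduled simultaneously. -/

import Mathlib

open MeasureTheory ProbabilityTheory

namespace AgeScheduling

/-- A schedule for `N` links, or the ON/OFF channel states of the `N` links in one slot:
`true` is the value `1` (scheduled, resp. ON), `false` the value `0`. -/
abbrev LinkVec (N : ℕ) := Fin N → Bool

/-- The real number `0` or `1` coded by a Boolean. -/
def ind (b : Bool) : ℝ := if b then 1 else 0

/-- The largest number of links that a feasible schedule activates simultaneously. -/
def maxScheduleSize {N : ℕ} (F : Finset (LinkVec N)) : ℕ :=
  F.sup fun s => (Finset.univ.filter fun n => s n = true).card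

/-! ### Quantities along one sample path

`x t n` is the reward offered on link `n` in slot `t`, `c t n` its channel state and `s t n`
tells whether it is scheduled. -/

/-- Age of information, with initial ages `z₀`. -/
def age {N : ℕ} (z₀ : Fin N → ℕ) (c s : ℕ → LinkVec N) : ℕ → Fin N → ℕ
  | 0, n => z₀ n
  | t + 1, n => if c t n = true ∧ s t n = true then 1 else age z₀ c s t n + 1

/-- `H_n(t)`: number of packets received over link `n` in slots `0, …, t - 1`. -/
def deliveries {N : ℕ} (c s : ℕ → LinkVec N) (t : ℕ) (n : Fin N) : ℕ :=
  ((Finset.range t).filter fun τ => c τ n = true ∧ s τ n = true).card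

/-- Sample mean of the rewards received over link `n` in slots `0, …, t - 1`
(equal to `1` if there are none). -/
noncomputable def sampleMean {N : ℕ} (x : ℕ → Fin N → ℝ) (c s : ℕ → LinkVec N)
    (t : ℕ) (n : Fin N) : ℝ :=
  if deliveries c s t n = 0 then 1
  else (∑ τ ∈ Finset.range t, x τ n * ind (c τ n) * ind (s τ n)) / (deliveries c s t n : ℝ)

/-- The truncated upper confidence bound `w_n(t)` (equal to `1` before the first delivery). -/
noncomputable def ucb {N : ℕ} (x : ℕ → Fin N → ℝ) (c s : ℕ → LinkVec N)
    (t : ℕ) (n : Fin N) : ℝ :=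
  if deliveries c s t n = 0 then 1
  else min (sampleMean x c s t n
    + Real.sqrt (3 * Real.log (t : ℝ) / (2 * (deliveries c s t n : ℝ)))) 1

/-- `s` is a schedule in `F` that maximizes `∑ n, v n * c n * s n` over `F`. -/
def IsMaxWeightSchedule {N : ℕ} (F : Finset (LinkVec N)) (v : Fin N → ℝ) (c s : LinkVec N) :
    Prop :=
  s ∈ F ∧ ∀ s' ∈ F, ∑ n, v n * ind (c n) * ind (s' n) ≤ ∑ n, v n * ind (c n) * ind (s n)

/-- The schedules `s` are selected by the Learning-based Age-Efficient Scheduling algorithm with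
parameter `η` along the sample path `x`, `c`: in every slot, a max-weight schedule for the weights
`Z_n(t) + η w_n(t)` is used (ties are broken arbitrarily). -/
def IsLAES {N : ℕ} (F : Finset (LinkVec N)) (η : ℝ) (z₀ : Fin N → ℕ)
    (x : ℕ → Fin N → ℝ) (c s : ℕ → LinkVec N) : Prop :=
  ∀ t, IsMaxWeightSchedule F (fun n => (age z₀ c s t n : ℝ) + η * ucb x c s t n) (c t) (s t)

/-! ### The stochastic model -/

variable {Ω : Type*} [mΩ : MeasurableSpace Ω]

/-- The random network: rewards `X t · n ∈ [0,1]`, for each link i.i.d. over time with mean `μ n`;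
ON/OFF channels `C t · n`, for each link i.i.d. over time and ON with positive probability.

`ℱ t` is the information on which the decision in slot `t` may be based: it contains the rewards of
the earlier slots and the channel states up to and including slot `t` (and possibly more, such as
private randomization used to break ties), and the rewards of slot `t` are independent of it.
If rewards and channels are independent and i.i.d. over time, the `σ`-algebras generated by
`(X s) (s < t)` and `(C s) (s ≤ t)` are an example. Different links may be dependent. -/
structure IsNetwork {N : ℕ} (P : Measure Ω) (ℱ : Filtration ℕ mΩ) (μ : Fin N → ℝ)
    (X : ℕ → Ω → Fin N → ℝ) (C : ℕ → Ω → LinkVec N) : Prop where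
  measurable_reward : ∀ t, Measurable (X t)
  reward_mem : ∀ t ω n, X t ω n ∈ Set.Icc (0 : ℝ) 1
  reward_indep : ∀ n, iIndepFun (fun t ω => X t ω n) P
  reward_identDistrib : ∀ t n, IdentDistrib (fun ω => X t ω n) (fun ω => X 0 ω n) P P
  reward_mean : ∀ t n, ∫ ω, X t ω n ∂P = μ n
  measurable_channel : ∀ t, Measurable (C t)
  channel_indep : ∀ n, iIndepFun (fun t ω => C t ω n) P
  channel_identDistrib : ∀ t n, IdentDistrib (fun ω => C t ω n) (fun ω => C 0 ω n) P P
  channel_pos : ∀ t n, 0 < P {ω | C t ω n = true}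
  past_reward_known : ∀ s t, s < t → Measurable[ℱ t] (X s)
  channel_known : ∀ t, Measurable[ℱ t] (C t)
  reward_indep_info : ∀ t, Indep (MeasurableSpace.comap (X t) inferInstance) (ℱ t) P

/-- Cumulative regret over the slots `0, …, T - 1` of the schedules `S` against `Sopt`. -/
noncomputable def regret {N : ℕ} (P : Measure Ω) (μ : Fin N → ℝ) (C : ℕ → Ω → LinkVec N)
    (Sopt S : ℕ → Ω → LinkVec N) (T : ℕ) : ℝ :=
  ∑ t ∈ Finset.range T, ∑ n,
    ((∫ ω, μ n * ind (C t ω n) * ind (Sopt t ω n) ∂P)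
      - ∫ ω, μ n * ind (C t ω n) * ind (S t ω n) ∂P)

end AgeScheduling

/-! Write `d` and `o` for the delivery indicators (channel times schedule) of the algorithm and of
the benchmark. Max-weight optimality compares `Z + η w` on both; dividing by `η` and dropping the
benchmark's nonnegative age term bounds the loss of a slot by the sum over links of `(w - μ)(d - o)
+ Z d / η` (`slot_regret_le`).

The age terms telescope: each delivery resets the age it collects, so a link contributes at most `T
/ η` in all (`sum_age_at_deliveries`).

If the empirical mean is within its confidence radius, then `0 ≤ w - μ ≤ √(6 log T / H)`, so the `o`
term can be dropped. Summing `d / √H` over time gives at most `2√H(T)` per link, and Cauchy–Schwarz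
over links, with at most `|S|_max T` deliveries in total, gives the square-root term. Slots with no
previous delivery cost at most 1 per link, hence the summand `N`.

Large deviations cost at most 1 per link and slot. Since past rewards influence which rewards are
sampled, the Chernoff bound comes from an exponential supermartingale; a union bound over the random
sample count gives probability at most `2 / t²` (`measureReal_abs_sampled_sum_gt_le`), with total at
most `π² / 3` per link. -/

namespace AgeScheduling

/-! ### Hoeffding bound for adaptively sampled variables -/

section Hoeffding

variable {Ω : Type*} [mΩ : MeasurableSpace Ω]

/-- The exponential process of adaptively sampled conditionally sub-Gaussian variables has
expectation at most one. -/
theorem lintegral_exp_sampled_sum_le_one (P : Measure Ω) [IsProbabilityMeasure P]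
    (ℱ : Filtration ℕ mΩ) (Y D : ℕ → Ω → ℝ) (a b : ℝ)
    (hYpast : ∀ s t, s < t → Measurable[ℱ t] (Y s))
    (hYindep : ∀ t, Indep (MeasurableSpace.comap (Y t) inferInstance) (ℱ t) P)
    (hYmgf : ∀ t, ∫⁻ ω, ENNReal.ofReal (Real.exp (a * Y t ω - b)) ∂P ≤ 1)
    (hD : ∀ t ω, D t ω = 0 ∨ D t ω = 1) (hDmeas : ∀ t, Measurable[ℱ t] (D t)) (t : ℕ) :
    ∫⁻ ω, ENNReal.ofReal (Real.exp (∑ τ ∈ Finset.range t, (a * Y τ ω - b) * D τ ω)) ∂P ≤ 1 := by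
  induction t with
  | zero => simp
  | succ t ih =>
    have hYm : Measurable (Y t) := (hYpast t (t + 1) (Nat.lt_succ_self t)).mono (ℱ.le _) le_rfl
    have hDm : Measurable (D t) := (hDmeas t).mono (ℱ.le _) le_rfl
    set M : Ω → ENNReal := fun ω =>
      ENNReal.ofReal (Real.exp (∑ τ ∈ Finset.range t, (a * Y τ ω - b) * D τ ω)) with hM
    have hsum : Measurable[ℱ t]
        (fun ω => ∑ τ ∈ Finset.range t, (a * Y τ ω - b) * D τ ω) := by
      refine Finset.measurable_fun_sum _ fun τ hτ => ?_
      have hτ' := Finset.mem_range.1 hτ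
      have h1 := hYpast τ t hτ'
      have h2 : Measurable[ℱ t] (D τ) := (hDmeas τ).mono (ℱ.mono hτ'.le) le_rfl
      exact ((h1.const_mul a).sub_const b).mul h2
    have hMmeas : Measurable[ℱ t] M := (Real.measurable_exp.comp hsum).ennreal_ofReal
    have hMmeas' : Measurable M := hMmeas.mono (ℱ.le _) le_rfl
    set E : Ω → ENNReal := fun ω => ENNReal.ofReal (Real.exp (a * Y t ω - b)) with hE
    have hEmeas : Measurable[MeasurableSpace.comap (Y t) inferInstance] E := by
      have h : Measurable fun y : ℝ => ENNReal.ofReal (Real.exp (a * y - b)) := by fun_prop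
      exact h.comp (comap_measurable (Y t))
    have hDo : Measurable[ℱ t] fun ω => ENNReal.ofReal (D t ω) := (hDmeas t).ennreal_ofReal
    have hDo' : Measurable[ℱ t] fun ω => ENNReal.ofReal (1 - D t ω) :=
      ((hDmeas t).const_sub 1).ennreal_ofReal
    have hMD : Measurable[ℱ t] fun ω => M ω * ENNReal.ofReal (D t ω) := hMmeas.mul hDo
    have hMD' : Measurable fun ω => M ω * ENNReal.ofReal (1 - D t ω) :=
      (hMmeas.mul hDo').mono (ℱ.le _) le_rfl
    -- As `D t` is 0 or 1, the new factor is `E` where `D t = 1` and 1 elsewhere. This isolates `E`,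
    -- a function of `Y t` alone, from `M * D t`, which is known at time `t`, so independence
    -- factors the integral.
    have hsplit : ∀ ω, ENNReal.ofReal
          (Real.exp (∑ τ ∈ Finset.range (t + 1), (a * Y τ ω - b) * D τ ω))
        = E ω * (M ω * ENNReal.ofReal (D t ω)) + M ω * ENNReal.ofReal (1 - D t ω) := by
      intro ω
      rw [Finset.sum_range_succ, Real.exp_add, ENNReal.ofReal_mul (Real.exp_pos _).le]
      rcases hD t ω with h | h <;> simp [h, hM, hE, mul_comm]
    calc ∫⁻ ω, ENNReal.ofReal
          (Real.exp (∑ τ ∈ Finset.range (t + 1), (a * Y τ ω - b) * D τ ω)) ∂P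
        = ∫⁻ ω, E ω * (M ω * ENNReal.ofReal (D t ω)) ∂P
          + ∫⁻ ω, M ω * ENNReal.ofReal (1 - D t ω) ∂P := by
          simp_rw [hsplit]
          exact lintegral_add_right _ hMD'
      _ = (∫⁻ ω, E ω ∂P) * (∫⁻ ω, M ω * ENNReal.ofReal (D t ω) ∂P)
          + ∫⁻ ω, M ω * ENNReal.ofReal (1 - D t ω) ∂P := by
          rw [lintegral_mul_eq_lintegral_mul_lintegral_of_independent_measurableSpace
            hYm.comap_le (ℱ.le t) (hYindep t) hEmeas hMD]
      _ ≤ 1 * (∫⁻ ω, M ω * ENNReal.ofReal (D t ω) ∂P)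
          + ∫⁻ ω, M ω * ENNReal.ofReal (1 - D t ω) ∂P := by
          gcongr
          exact hYmgf t
      _ = ∫⁻ ω, M ω ∂P := by
          rw [one_mul, ← lintegral_add_right _ hMD']
          refine lintegral_congr fun ω => ?_
          rcases hD t ω with h | h <;> simp [h]
      _ ≤ 1 := ih

/-- Hoeffding's lemma for variables in the unit interval. -/
theorem lintegral_exp_centered_le_one (P : Measure Ω) [IsProbabilityMeasure P] {X : Ω → ℝ}
    (hX : Measurable X) (hX01 : ∀ ω, X ω ∈ Set.Icc (0 : ℝ) 1) (l : ℝ) :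
    ∫⁻ ω, ENNReal.ofReal (Real.exp (l * (X ω - ∫ ω, X ω ∂P) - l ^ 2 / 8)) ∂P ≤ 1 := by
  have hsub := hasSubgaussianMGF_of_mem_Icc (μ := P) hX.aemeasurable
    (Filter.Eventually.of_forall hX01)
  have hint := hsub.integrable_exp_mul l
  have hmgf := hsub.mgf_le l
  simp_rw [Real.exp_sub]
  rw [← ofReal_integral_eq_lintegral_ofReal (hint.div_const _)
    (Filter.Eventually.of_forall fun ω => by positivity), integral_div]
  -- An interval of length 1 has sub-Gaussian variance proxy `(1 / 2)²`, whence the exponent `l² /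
  -- 8`.
  refine ENNReal.ofReal_le_one.2 ((div_le_one (Real.exp_pos _)).2 (hmgf.trans_eq ?_))
  congr 1
  norm_num
  ring

/-- Chernoff bound for adaptively sampled variables, on the event of `h` samples. -/
theorem measure_sampled_sum_ge_le (P : Measure Ω) [IsProbabilityMeasure P]
    (ℱ : Filtration ℕ mΩ) (X : ℕ → Ω → ℝ) (D : ℕ → Ω → ℝ) (m : ℝ)
    (hXmeas : ∀ t, Measurable (X t)) (hX01 : ∀ t ω, X t ω ∈ Set.Icc (0 : ℝ) 1)
    (hXmean : ∀ t, ∫ ω, X t ω ∂P = m)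
    (hXpast : ∀ s t, s < t → Measurable[ℱ t] (X s))
    (hXindep : ∀ t, Indep (MeasurableSpace.comap (X t) inferInstance) (ℱ t) P)
    (hD : ∀ t ω, D t ω = 0 ∨ D t ω = 1) (hDmeas : ∀ t, Measurable[ℱ t] (D t))
    (t : ℕ) (h : ℝ) (l u : ℝ) :
    P {ω | ∑ τ ∈ Finset.range t, D τ ω = h ∧
        u ≤ l * ∑ τ ∈ Finset.range t, (X τ ω - m) * D τ ω}
      ≤ ENNReal.ofReal (Real.exp (l ^ 2 / 8 * h - u)) := by
  have hDm : ∀ t, Measurable (D t) := fun t => (hDmeas t).mono (ℱ.le _) le_rfl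
  have hexp := lintegral_exp_sampled_sum_le_one P ℱ (fun t ω => X t ω - m) D l (l ^ 2 / 8)
    (fun s t hst => (hXpast s t hst).sub_const m)
    (fun t => by
      refine indep_of_indep_of_le_left (hXindep t) ?_
      have h : Measurable fun y : ℝ => y - m := by fun_prop
      exact (h.comp (comap_measurable (X t))).comap_le)
    (fun t => by simpa only [hXmean t] using
      lintegral_exp_centered_le_one P (hXmeas t) (hX01 t) l) hD hDmeas t
  set f : Ω → ENNReal := fun ω => ENNReal.ofReal
    (Real.exp (∑ τ ∈ Finset.range t, (l * (X τ ω - m) - l ^ 2 / 8) * D τ ω)) with hf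
  have hfm : Measurable f := by
    have : Measurable fun ω => ∑ τ ∈ Finset.range t, (l * (X τ ω - m) - l ^ 2 / 8) * D τ ω :=
      Finset.measurable_fun_sum _ fun τ _ =>
        ((((hXmeas τ).sub_const m).const_mul l).sub_const _).mul (hDm τ)
    exact (Real.measurable_exp.comp this).ennreal_ofReal
  -- Fixing the sample count makes the compensator the constant `l² / 8 * h`, so Markov's inequality
  -- applies to `f`.
  have hsub : {ω | ∑ τ ∈ Finset.range t, D τ ω = h ∧
        u ≤ l * ∑ τ ∈ Finset.range t, (X τ ω - m) * D τ ω}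
      ⊆ {ω | ENNReal.ofReal (Real.exp (u - l ^ 2 / 8 * h)) ≤ f ω} := by
    rintro ω ⟨h1, h2⟩
    refine ENNReal.ofReal_le_ofReal (Real.exp_le_exp.2 ?_)
    have : ∑ τ ∈ Finset.range t, (l * (X τ ω - m) - l ^ 2 / 8) * D τ ω
        = l * ∑ τ ∈ Finset.range t, (X τ ω - m) * D τ ω
          - l ^ 2 / 8 * ∑ τ ∈ Finset.range t, D τ ω := by
      rw [Finset.mul_sum, Finset.mul_sum, ← Finset.sum_sub_distrib]
      exact Finset.sum_congr rfl fun _ _ => by ring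
    rw [this, h1]
    linarith
  refine (measure_mono hsub).trans ?_
  refine (meas_ge_le_lintegral_div hfm.aemeasurable
    (by simpa using Real.exp_pos _) ENNReal.ofReal_ne_top).trans ?_
  refine (ENNReal.div_le_div_right hexp _).trans ?_
  rw [one_div, ← ENNReal.ofReal_inv_of_pos (Real.exp_pos _), ← Real.exp_neg, neg_sub]

/-- Two-sided deviation bound for adaptively sampled variables, uniform in the number of
samples. -/
theorem measureReal_abs_sampled_sum_gt_le (P : Measure Ω) [IsProbabilityMeasure P]
    (ℱ : Filtration ℕ mΩ) (X : ℕ → Ω → ℝ) (D : ℕ → Ω → ℝ) (m : ℝ)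
    (hXmeas : ∀ t, Measurable (X t)) (hX01 : ∀ t ω, X t ω ∈ Set.Icc (0 : ℝ) 1)
    (hXmean : ∀ t, ∫ ω, X t ω ∂P = m)
    (hXpast : ∀ s t, s < t → Measurable[ℱ t] (X s))
    (hXindep : ∀ t, Indep (MeasurableSpace.comap (X t) inferInstance) (ℱ t) P)
    (hD : ∀ t ω, D t ω = 0 ∨ D t ω = 1) (hDmeas : ∀ t, Measurable[ℱ t] (D t))
    (t : ℕ) (H : Ω → ℕ) (hH : ∀ ω, (H ω : ℝ) = ∑ τ ∈ Finset.range t, D τ ω) :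
    P.real {ω | 0 < H ω ∧ H ω * Real.sqrt (3 * Real.log t / (2 * H ω))
        < |∑ τ ∈ Finset.range t, (X τ ω - m) * D τ ω|} ≤ 2 * (1 / (t : ℝ) ^ 2) := by
  rcases Nat.eq_zero_or_pos t with rfl | ht
  -- The right side is 0 here because `1 / 0 = 0`, but the event is empty.
  · have : ∀ ω, H ω = 0 := fun ω => by exact_mod_cast (by simpa using hH ω : (H ω : ℝ) = 0)
    simp [this]
  have htR : (0 : ℝ) < t := by exact_mod_cast ht
  have hlog : 0 ≤ Real.log t := Real.log_natCast_nonneg t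
  have hHle : ∀ ω, H ω ≤ t := fun ω => by
    have : (H ω : ℝ) ≤ t := by
      rw [hH ω]
      calc ∑ τ ∈ Finset.range t, D τ ω ≤ ∑ τ ∈ Finset.range t, (1 : ℝ) :=
            Finset.sum_le_sum fun τ _ => by rcases hD τ ω with h | h <;> simp [h]
        _ = t := by simp
    exact_mod_cast this
  set ε : ℕ → ℝ := fun h => Real.sqrt (3 * Real.log t / (2 * h)) with hε
  -- The sign `σ` selects the tail. The slope `l = 4 ε h` minimizes `l² h / 8 - l h ε`; the minimum
  -- `-2 h ε²` equals `-3 log t`, so each event has probability at most `t⁻³`.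
  set A : ℝ → ℕ → Set Ω := fun σ h => {ω | ∑ τ ∈ Finset.range t, D τ ω = h ∧
        4 * h * ε h ^ 2 ≤ (σ * (4 * ε h)) * ∑ τ ∈ Finset.range t, (X τ ω - m) * D τ ω} with hA
  have hAle : ∀ σ : ℝ, σ ^ 2 = 1 → ∀ h : ℕ, 0 < h → P.real (A σ h) ≤ ((t : ℝ) ^ 3)⁻¹ := by
    intro σ hσ h hh
    have hhR : (0 : ℝ) < h := by exact_mod_cast hh
    have hb := measure_sampled_sum_ge_le P ℱ X D m hXmeas hX01 hXmean hXpast hXindep hD hDmeas t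
      h (σ * (4 * ε h)) (4 * h * ε h ^ 2)
    have hsq : ε h ^ 2 = 3 * Real.log t / (2 * h) := Real.sq_sqrt (by positivity)
    have hval : (σ * (4 * ε h)) ^ 2 / 8 * h - 4 * h * ε h ^ 2 = -(3 * Real.log t) := by
      rw [mul_pow, hσ, mul_pow, hsq]
      field_simp
      ring
    have hpow : Real.exp (-(3 * Real.log t)) = ((t : ℝ) ^ 3)⁻¹ := by
      rw [Real.exp_neg, ← Real.exp_log (pow_pos htR 3), Real.log_pow]
      norm_num
    rw [hval, hpow] at hb
    exact ENNReal.toReal_le_of_le_ofReal (by positivity) hb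
  have hsub : {ω | 0 < H ω ∧ H ω * Real.sqrt (3 * Real.log t / (2 * H ω))
        < |∑ τ ∈ Finset.range t, (X τ ω - m) * D τ ω|}
      ⊆ ⋃ h ∈ Finset.Icc 1 t, (A 1 h ∪ A (-1) h) := by
    rintro ω ⟨h0, h1⟩
    simp only [Set.mem_iUnion]
    refine ⟨H ω, Finset.mem_Icc.2 ⟨h0, hHle ω⟩, ?_⟩
    have hε0 : 0 ≤ ε (H ω) := Real.sqrt_nonneg _
    change H ω * ε (H ω) < _ at h1
    rcases lt_abs.1 h1 with h2 | h2
    · left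
      refine ⟨(hH ω).symm, ?_⟩
      nlinarith [mul_le_mul_of_nonneg_left h2.le hε0]
    · right
      refine ⟨(hH ω).symm, ?_⟩
      nlinarith [mul_le_mul_of_nonneg_left h2.le hε0]
  calc P.real _ ≤ P.real (⋃ h ∈ Finset.Icc 1 t, (A 1 h ∪ A (-1) h)) := measureReal_mono hsub (measure_ne_top _ _)
    _ ≤ ∑ h ∈ Finset.Icc 1 t, P.real (A 1 h ∪ A (-1) h) := measureReal_biUnion_finset_le _ _
    -- Two tails and `t` possible counts turn `t⁻³` into `2 / t²`.
    _ ≤ ∑ h ∈ Finset.Icc 1 t, 2 * ((t : ℝ) ^ 3)⁻¹ := by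
        refine Finset.sum_le_sum fun h hh => ?_
        have hh' : 0 < h := (Finset.mem_Icc.1 hh).1
        have h1 := hAle 1 (by norm_num) h hh'
        have h2 := hAle (-1) (by norm_num) h hh'
        linarith [measureReal_union_le (μ := P) (A 1 h) (A (-1) h)]
    _ = 2 * (1 / (t : ℝ) ^ 2) := by
        simp only [Finset.sum_const, Nat.card_Icc, Nat.add_sub_cancel, nsmul_eq_mul]
        field_simp

end Hoeffding

end AgeScheduling

namespace AgeScheduling

/-! ### Bounds along one sample path -/

section SamplePath

variable {N : ℕ}

theorem ind_nonneg (b : Bool) : 0 ≤ ind b := by cases b <;> simp [ind]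

theorem ind_le_one (b : Bool) : ind b ≤ 1 := by cases b <;> simp [ind]

theorem ind_mul_ind_eq_zero_or_one (a b : Bool) : ind a * ind b = 0 ∨ ind a * ind b = 1 := by
  cases a <;> cases b <;> simp [ind]

theorem deliveries_succ (c s : ℕ → LinkVec N) (t : ℕ) (n : Fin N) :
    deliveries c s (t + 1) n
      = deliveries c s t n + if c t n = true ∧ s t n = true then 1 else 0 := by
  unfold deliveries
  rw [Finset.range_add_one, Finset.filter_insert]
  split_ifs <;> simp

theorem deliveries_eq_sum (c s : ℕ → LinkVec N) (t : ℕ) (n : Fin N) :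
    (deliveries c s t n : ℝ) = ∑ τ ∈ Finset.range t, ind (c τ n) * ind (s τ n) := by
  induction t with
  | zero => simp [deliveries]
  | succ t ih =>
    rw [deliveries_succ, Finset.sum_range_succ, ← ih]
    cases c t n <;> cases s t n <;> simp [ind]

/-- The ages at the delivery times add up to the elapsed time minus the current age. -/
theorem sum_age_at_deliveries (z₀ : Fin N → ℕ) (c s : ℕ → LinkVec N) (T : ℕ) (n : Fin N) :
    (∑ t ∈ Finset.range T, (age z₀ c s t n : ℝ) * (ind (c t n) * ind (s t n)))
      + age z₀ c s T n = T + z₀ n := by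
  induction T with
  | zero => simp [age]
  | succ T ih =>
    rw [Finset.sum_range_succ, age]
    push_cast
    rw [show ((T : ℝ) + 1 + z₀ n) = T + z₀ n + 1 by ring, ← ih]
    cases c T n <;> cases s T n <;> simp [ind, add_assoc]

theorem sum_first_delivery_le_one (c s : ℕ → LinkVec N) (T : ℕ) (n : Fin N) :
    (∑ t ∈ Finset.range T,
      (if deliveries c s t n = 0 then ind (c t n) * ind (s t n) else 0)) ≤ 1 := by
  -- The induction needs the sharper claim that nothing accumulates before the first delivery.
  suffices h : (∑ t ∈ Finset.range T,
      (if deliveries c s t n = 0 then ind (c t n) * ind (s t n) else 0))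
        ≤ if deliveries c s T n = 0 then 0 else 1 from
    h.trans (by split_ifs <;> norm_num)
  induction T with
  | zero => simp [deliveries]
  | succ T ih =>
    rw [Finset.sum_range_succ, deliveries_succ]
    cases c T n <;> cases s T n <;> simp [ind] at ih ⊢ <;> split_ifs at ih ⊢ <;> linarith

/-- The discrete form of integrating `1 / √h`. The first delivery contributes 0 because division by
`√0` gives 0; hence the induction can carry `H - 1` under the root. -/
theorem sum_inv_sqrt_deliveries_le (c s : ℕ → LinkVec N) (T : ℕ) (n : Fin N) :
    (∑ t ∈ Finset.range T, (ind (c t n) * ind (s t n)) / Real.sqrt (deliveries c s t n))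
      ≤ 2 * Real.sqrt (deliveries c s T n) := by
  suffices h : (∑ t ∈ Finset.range T,
      (ind (c t n) * ind (s t n)) / Real.sqrt (deliveries c s t n))
        ≤ 2 * Real.sqrt ((deliveries c s T n : ℝ) - 1) from
    h.trans (by gcongr; linarith)
  induction T with
  | zero => simp
  | succ T ih =>
    rw [Finset.sum_range_succ, deliveries_succ]
    have hstep : ∀ h : ℕ, 2 * Real.sqrt ((h : ℝ) - 1) + 1 / Real.sqrt h ≤ 2 * Real.sqrt h := by
      intro h
      rcases Nat.eq_zero_or_pos h with rfl | hh
      · simp [Real.sqrt_eq_zero_of_nonpos]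
      have h1 : (1 : ℝ) ≤ h := by exact_mod_cast hh
      have hpos : 0 < Real.sqrt h := Real.sqrt_pos.2 (by linarith)
      have ha := Real.sq_sqrt (by linarith : (0 : ℝ) ≤ h)
      have hb := Real.sq_sqrt (by linarith : (0 : ℝ) ≤ (h : ℝ) - 1)
      rw [← le_sub_iff_add_le', div_le_iff₀ hpos]
      -- The expanded square is exactly `2√h (√h - √(h - 1)) ≥ 1`.
      nlinarith [sq_nonneg (Real.sqrt h - Real.sqrt ((h : ℝ) - 1))]
    have := hstep (deliveries c s T n)
    cases c T n <;> cases s T n <;> simp [ind] at ih this ⊢ <;> linarith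

/-- The total number of deliveries is limited by the size of the schedules. -/
theorem sum_deliveries_le (F : Finset (LinkVec N)) (c s : ℕ → LinkVec N)
    (hs : ∀ t, s t ∈ F) (T : ℕ) :
    (∑ n, (deliveries c s T n : ℝ)) ≤ maxScheduleSize F * T := by
  simp_rw [deliveries_eq_sum]
  rw [Finset.sum_comm]
  calc ∑ t ∈ Finset.range T, ∑ n, ind (c t n) * ind (s t n)
      ≤ ∑ t ∈ Finset.range T, (maxScheduleSize F : ℝ) := by
        refine Finset.sum_le_sum fun t _ => ?_
        have h1 : (Finset.univ.filter fun n => s t n = true).card ≤ maxScheduleSize F :=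
          Finset.le_sup (f := fun s : LinkVec N =>
            (Finset.univ.filter fun n => s n = true).card) (hs t)
        calc ∑ n, ind (c t n) * ind (s t n) ≤ ∑ n, ind (s t n) :=
              Finset.sum_le_sum fun n _ =>
                mul_le_of_le_one_left (ind_nonneg _) (ind_le_one _)
          _ = (Finset.univ.filter fun n => s t n = true).card := by simp [ind]
          _ ≤ maxScheduleSize F := by exact_mod_cast h1
    _ = maxScheduleSize F * T := by simp [mul_comm]

/-- The event that the centered sum of the rewards received on link `n` before slot `t` exceeds
the confidence radius. -/
def LargeDeviation (μ : Fin N → ℝ) (x : ℕ → Fin N → ℝ) (c s : ℕ → LinkVec N)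
    (t : ℕ) (n : Fin N) : Prop :=
  0 < deliveries c s t n ∧
    deliveries c s t n * Real.sqrt (3 * Real.log t / (2 * deliveries c s t n))
      < |∑ τ ∈ Finset.range t, (x τ n - μ n) * (ind (c τ n) * ind (s τ n))|

theorem ucb_mem_Icc (x : ℕ → Fin N → ℝ) (hx : ∀ t n, x t n ∈ Set.Icc (0 : ℝ) 1)
    (c s : ℕ → LinkVec N) (t : ℕ) (n : Fin N) : ucb x c s t n ∈ Set.Icc (0 : ℝ) 1 := by
  unfold ucb
  split_ifs with h
  · simp
  refine ⟨le_min (add_nonneg ?_ (Real.sqrt_nonneg _)) zero_le_one, min_le_right _ _⟩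
  rw [sampleMean, if_neg h]
  exact div_nonneg (Finset.sum_nonneg fun τ _ =>
    mul_nonneg (mul_nonneg (hx τ n).1 (ind_nonneg _)) (ind_nonneg _)) (Nat.cast_nonneg _)

/-- Outside the large deviation event the upper confidence bound is at least the mean and exceeds
it by at most twice the confidence radius. -/
theorem ucb_sub_mean_bounds (μ : Fin N → ℝ) (hμ : ∀ n, μ n ≤ 1) (x : ℕ → Fin N → ℝ)
    (c s : ℕ → LinkVec N) (t : ℕ) (n : Fin N) (hpos : 0 < deliveries c s t n)
    (hgood : ¬ LargeDeviation μ x c s t n) :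
    μ n ≤ ucb x c s t n ∧
      ucb x c s t n - μ n ≤ 2 * Real.sqrt (3 * Real.log t / (2 * deliveries c s t n)) := by
  have hne : deliveries c s t n ≠ 0 := hpos.ne'
  have hH : (0 : ℝ) < deliveries c s t n := by exact_mod_cast hpos
  set ε := Real.sqrt (3 * Real.log t / (2 * deliveries c s t n)) with hε
  have hdev : |∑ τ ∈ Finset.range t, (x τ n - μ n) * (ind (c τ n) * ind (s τ n))|
      ≤ deliveries c s t n * ε := by
    by_contra! h
    exact hgood ⟨hpos, h⟩
  have hsum : ∑ τ ∈ Finset.range t, (x τ n - μ n) * (ind (c τ n) * ind (s τ n))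
      = deliveries c s t n * (sampleMean x c s t n - μ n) := by
    rw [sampleMean, if_neg hne, mul_sub, mul_div_cancel₀ _ hH.ne', deliveries_eq_sum,
      Finset.sum_mul, ← Finset.sum_sub_distrib]
    exact Finset.sum_congr rfl fun _ _ => by ring
  rw [hsum, abs_mul, abs_of_pos hH, mul_le_mul_iff_right₀ hH, abs_le] at hdev
  have hucb : ucb x c s t n = min (sampleMean x c s t n + ε) 1 := by rw [ucb, if_neg hne]
  rw [hucb]
  -- Truncation at 1 preserves the lower bound because `μ n ≤ 1`.
  refine ⟨le_min (by linarith) (hμ n), ?_⟩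
  linarith [min_le_left (sampleMean x c s t n + ε) 1]

open Classical in
/-- Contribution of one link to the regret of one slot, apart from the age term. -/
theorem ucb_sub_mean_mul_le (μ : Fin N → ℝ) (hμ : ∀ n, μ n ∈ Set.Icc (0 : ℝ) 1)
    (x : ℕ → Fin N → ℝ) (hx : ∀ t n, x t n ∈ Set.Icc (0 : ℝ) 1) (c s : ℕ → LinkVec N)
    {t T : ℕ} (htT : t < T) (n : Fin N) (b : Bool) :
    (ucb x c s t n - μ n) * (ind (c t n) * ind (s t n) - ind (c t n) * ind b)
      ≤ (if LargeDeviation μ x c s t n then 1 else 0)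
        + (if deliveries c s t n = 0 then ind (c t n) * ind (s t n) else 0)
        + Real.sqrt (6 * Real.log T)
          * (ind (c t n) * ind (s t n) / Real.sqrt (deliveries c s t n)) := by
  have hw := ucb_mem_Icc x hx c s t n
  have hd0 : 0 ≤ ind (c t n) * ind (s t n) := mul_nonneg (ind_nonneg _) (ind_nonneg _)
  have ho0 : 0 ≤ ind (c t n) * ind b := mul_nonneg (ind_nonneg _) (ind_nonneg _)
  have hd1 : ind (c t n) * ind (s t n) ≤ 1 := mul_le_one₀ (ind_le_one _) (ind_nonneg _) (ind_le_one _)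
  have ho1 : ind (c t n) * ind b ≤ 1 := mul_le_one₀ (ind_le_one _) (ind_nonneg _) (ind_le_one _)
  set d := ind (c t n) * ind (s t n) with hd
  set o := ind (c t n) * ind b with ho
  have hlast : 0 ≤ Real.sqrt (6 * Real.log T) * (d / Real.sqrt (deliveries c s t n)) := by
    positivity
  by_cases hbad : LargeDeviation μ x c s t n
  · have hfirst : 0 ≤ (if deliveries c s t n = 0 then d else 0) := by split_ifs <;> simp [hd0]
    rw [if_pos hbad]
    have h1 : |ucb x c s t n - μ n| ≤ 1 :=
      abs_le.2 ⟨by linarith [hw.1, (hμ n).2], by linarith [hw.2, (hμ n).1]⟩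
    have h2 : |d - o| ≤ 1 := abs_le.2 ⟨by linarith, by linarith⟩
    have h3 : |(ucb x c s t n - μ n) * (d - o)| ≤ 1 := by
      rw [abs_mul]
      exact mul_le_one₀ h1 (abs_nonneg _) h2
    linarith [le_abs_self ((ucb x c s t n - μ n) * (d - o))]
  rw [if_neg hbad]
  by_cases hz : deliveries c s t n = 0
  · rw [if_pos hz]
    have h1 : ucb x c s t n = 1 := by rw [ucb, if_pos hz]
    have h2 := hμ n
    rw [h1]
    nlinarith [h2.1, h2.2, mul_nonneg (sub_nonneg.2 h2.2) ho0, mul_nonneg h2.1 hd0]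
  · rw [if_neg hz]
    obtain ⟨h1, h2⟩ := ucb_sub_mean_bounds μ (fun n => (hμ n).2) x c s t n
      (Nat.pos_of_ne_zero hz) hbad
    -- A delivery before slot `t` forces `t > 0`, as monotonicity of the logarithm requires.
    have ht0 : 0 < t := by
      rcases Nat.eq_zero_or_pos t with rfl | h
      · simp [deliveries] at hz
      · exact h
    have hH : (0 : ℝ) < deliveries c s t n := by exact_mod_cast Nat.pos_of_ne_zero hz
    have hlog : Real.log t ≤ Real.log T :=
      Real.log_le_log (by exact_mod_cast ht0) (by exact_mod_cast htT.le)
    have hrad : 2 * Real.sqrt (3 * Real.log t / (2 * deliveries c s t n))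
        ≤ Real.sqrt (6 * Real.log T) / Real.sqrt (deliveries c s t n) := by
      rw [← Real.sqrt_div' _ hH.le]
      refine Real.le_sqrt_of_sq_le ?_
      rw [mul_pow, Real.sq_sqrt (div_nonneg (mul_nonneg (by norm_num)
        (Real.log_natCast_nonneg t)) (by positivity))]
      have : (2 : ℝ) ^ 2 * (3 * Real.log t / (2 * deliveries c s t n))
          = 6 * Real.log t / deliveries c s t n := by field_simp; ring
      rw [this]
      gcongr
    -- Optimism, `μ n ≤ ucb`, makes the benchmark's contribution nonpositive.
    have h3 : (ucb x c s t n - μ n) * (d - o) ≤ (ucb x c s t n - μ n) * d :=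
      mul_le_mul_of_nonneg_left (by linarith) (by linarith)
    have h4 := mul_le_mul_of_nonneg_right (h2.trans hrad) hd0
    have h5 : Real.sqrt (6 * Real.log T) * (d / Real.sqrt (deliveries c s t n))
        = Real.sqrt (6 * Real.log T) / Real.sqrt (deliveries c s t n) * d := by ring
    linarith

/-- The loss in one slot of a schedule chosen by the algorithm. -/
theorem slot_regret_le (F : Finset (LinkVec N)) (μ : Fin N → ℝ) {η : ℝ} (hη : 0 < η)
    (Z w : Fin N → ℝ) (hZ : ∀ n, 0 ≤ Z n) (c s o : LinkVec N) (ho : o ∈ F)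
    (hs : IsMaxWeightSchedule F (fun n => Z n + η * w n) c s) :
    ∑ n, (μ n * ind (c n) * ind (o n) - μ n * ind (c n) * ind (s n))
      ≤ ∑ n, ((w n - μ n) * (ind (c n) * ind (s n) - ind (c n) * ind (o n))
        + Z n * (ind (c n) * ind (s n)) / η) := by
  have h := hs.2 o ho
  -- Two nonnegative quantities are added: the benchmark's age weight over `η`, and the max-weight
  -- gap over `η`. What follows is an algebraic identity.
  have hstep : ∑ n, (μ n * ind (c n) * ind (o n) - μ n * ind (c n) * ind (s n))
      ≤ ∑ n, (μ n * ind (c n) * ind (o n) - μ n * ind (c n) * ind (s n)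
        + Z n * (ind (c n) * ind (o n)) / η)
        + ((∑ n, (Z n + η * w n) * ind (c n) * ind (s n))
          - ∑ n, (Z n + η * w n) * ind (c n) * ind (o n)) / η := by
    have h1 : 0 ≤ ((∑ n, (Z n + η * w n) * ind (c n) * ind (s n))
          - ∑ n, (Z n + η * w n) * ind (c n) * ind (o n)) / η :=
      div_nonneg (sub_nonneg.2 h) hη.le
    have h2 : 0 ≤ ∑ n, Z n * (ind (c n) * ind (o n)) / η := Finset.sum_nonneg fun n _ =>
      div_nonneg (mul_nonneg (hZ n) (mul_nonneg (ind_nonneg _) (ind_nonneg _))) hη.le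
    rw [Finset.sum_add_distrib (f := fun n =>
      μ n * ind (c n) * ind (o n) - μ n * ind (c n) * ind (s n))]
    linarith
  refine hstep.trans_eq ?_
  rw [← Finset.sum_sub_distrib, Finset.sum_div, ← Finset.sum_add_distrib]
  refine Finset.sum_congr rfl fun n _ => ?_
  field_simp
  ring

/-- Cauchy–Schwarz against the constant vector; it passes from per-link delivery counts to their
total. -/
theorem sum_sqrt_le_sqrt_card_mul_sum (a : Fin N → ℝ) (ha : ∀ n, 0 ≤ a n) :
    ∑ n, Real.sqrt (a n) ≤ Real.sqrt (N * ∑ n, a n) := by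
  refine Real.le_sqrt_of_sq_le ?_
  have h := sq_sum_le_card_mul_sum_sq (s := Finset.univ) (f := fun n => Real.sqrt (a n))
  simpa [Real.sq_sqrt (ha _)] using h

open Classical in
/-- Regret bound along one sample path, up to the number of large deviation events. -/
theorem path_regret_le (F : Finset (LinkVec N)) (μ : Fin N → ℝ)
    (hμ : ∀ n, μ n ∈ Set.Icc (0 : ℝ) 1) {η : ℝ} (hη : 0 < η)
    (z₀ : Fin N → ℕ) (hz₀ : ∀ n, z₀ n = 0)
    (x : ℕ → Fin N → ℝ) (hx : ∀ t n, x t n ∈ Set.Icc (0 : ℝ) 1) (c s o : ℕ → LinkVec N)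
    (hs : IsLAES F η z₀ x c s) (ho : ∀ t, o t ∈ F) (T : ℕ) :
    ∑ t ∈ Finset.range T, ∑ n,
        (μ n * ind (c t n) * ind (o t n) - μ n * ind (c t n) * ind (s t n))
      ≤ (N : ℝ) * T / η
        + 2 * Real.sqrt (6 * N * (maxScheduleSize F : ℝ) * T * Real.log T) + N
        + ∑ t ∈ Finset.range T, ∑ n, (if LargeDeviation μ x c s t n then (1 : ℝ) else 0) := by
  have hage : ∀ n, (∑ t ∈ Finset.range T,
      (age z₀ c s t n : ℝ) * (ind (c t n) * ind (s t n)) / η) ≤ T / η := by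
    intro n
    rw [← Finset.sum_div]
    have h := sum_age_at_deliveries z₀ c s T n
    rw [hz₀ n] at h
    have h0 : (0 : ℝ) ≤ age z₀ c s T n := Nat.cast_nonneg _
    gcongr
    push_cast at h
    linarith
  have hlog : 0 ≤ Real.log T := Real.log_natCast_nonneg T
  have hsqrt : ∑ n, Real.sqrt (6 * Real.log T) * (2 * Real.sqrt (deliveries c s T n))
      ≤ 2 * Real.sqrt (6 * N * (maxScheduleSize F : ℝ) * T * Real.log T) := by
    have h1 := (sum_sqrt_le_sqrt_card_mul_sum (fun n => (deliveries c s T n : ℝ))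
      (fun n => Nat.cast_nonneg _)).trans (Real.sqrt_le_sqrt
        (mul_le_mul_of_nonneg_left (sum_deliveries_le F c s (fun t => (hs t).1) T)
          (Nat.cast_nonneg N)))
    rw [← Finset.mul_sum, ← Finset.mul_sum]
    calc Real.sqrt (6 * Real.log T) * (2 * ∑ n, Real.sqrt (deliveries c s T n))
        ≤ Real.sqrt (6 * Real.log T)
          * (2 * Real.sqrt (N * ((maxScheduleSize F : ℝ) * T))) := by gcongr
      _ = 2 * (Real.sqrt (6 * Real.log T)
          * Real.sqrt (N * ((maxScheduleSize F : ℝ) * T))) := by ring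
      _ = 2 * Real.sqrt (6 * N * (maxScheduleSize F : ℝ) * T * Real.log T) := by
          rw [← Real.sqrt_mul (by positivity)]
          congr 2
          ring
  calc ∑ t ∈ Finset.range T, ∑ n,
        (μ n * ind (c t n) * ind (o t n) - μ n * ind (c t n) * ind (s t n))
      ≤ ∑ t ∈ Finset.range T, ∑ n,
        (((if LargeDeviation μ x c s t n then (1 : ℝ) else 0)
          + (if deliveries c s t n = 0 then ind (c t n) * ind (s t n) else 0)
          + Real.sqrt (6 * Real.log T)
            * (ind (c t n) * ind (s t n) / Real.sqrt (deliveries c s t n)))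
          + (age z₀ c s t n : ℝ) * (ind (c t n) * ind (s t n)) / η) := by
        refine Finset.sum_le_sum fun t ht => ?_
        refine (slot_regret_le F μ hη (fun n => (age z₀ c s t n : ℝ)) (ucb x c s t)
          (fun n => Nat.cast_nonneg _) (c t) (s t) (o t) (ho t) (hs t)).trans ?_
        refine Finset.sum_le_sum fun n _ => add_le_add_left ?_ _
        exact ucb_sub_mean_mul_le μ hμ x hx c s (Finset.mem_range.1 ht) n (o t n)
    _ = (∑ t ∈ Finset.range T, ∑ n, (if LargeDeviation μ x c s t n then (1 : ℝ) else 0))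
        + (∑ n, ∑ t ∈ Finset.range T,
          (if deliveries c s t n = 0 then ind (c t n) * ind (s t n) else 0))
        + (∑ n, Real.sqrt (6 * Real.log T) * ∑ t ∈ Finset.range T,
            (ind (c t n) * ind (s t n) / Real.sqrt (deliveries c s t n)))
        + ∑ n, ∑ t ∈ Finset.range T,
          (age z₀ c s t n : ℝ) * (ind (c t n) * ind (s t n)) / η := by
        simp_rw [Finset.sum_add_distrib, Finset.mul_sum]
        congr 1
        · congr 1
          · congr 1
            exact Finset.sum_comm
          · exact Finset.sum_comm
        · exact Finset.sum_comm
    _ ≤ (∑ t ∈ Finset.range T, ∑ n, (if LargeDeviation μ x c s t n then (1 : ℝ) else 0))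
        + (∑ _n : Fin N, 1)
        + (∑ n, Real.sqrt (6 * Real.log T) * (2 * Real.sqrt (deliveries c s T n)))
        + ∑ _n : Fin N, T / η := by
        gcongr with n _ n _ n _
        · exact sum_first_delivery_le_one c s T n
        · exact sum_inv_sqrt_deliveries_le c s T n
        · exact hage n
    _ ≤ _ := by
        have h1 : ∑ _n : Fin N, (1 : ℝ) = N := by simp
        have h2 : ∑ _n : Fin N, (T : ℝ) / η = N * T / η := by simp [mul_div_assoc]
        rw [h1, h2]
        linarith

end SamplePath

end AgeScheduling

namespace AgeScheduling

/-! ### Measurability, integrability and deviation probabilities in the stochastic model. -/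

section Network

variable {Ω : Type*} [mΩ : MeasurableSpace Ω]

theorem measurable_ind : Measurable ind := measurable_of_countable _

theorem integrable_mul_ind_mul_ind (P : Measure Ω) [IsProbabilityMeasure P] {N : ℕ}
    {c s : Ω → LinkVec N} (hc : Measurable c) (hs : Measurable s) (m : ℝ) (n : Fin N) :
    Integrable (fun ω => m * ind (c ω n) * ind (s ω n)) P := by
  have hcn : Measurable fun ω => ind (c ω n) := measurable_ind.comp ((measurable_pi_apply n).comp hc)
  have hsn : Measurable fun ω => ind (s ω n) := measurable_ind.comp ((measurable_pi_apply n).comp hs)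
  refine Integrable.of_bound ((hcn.const_mul m).mul hsn).aestronglyMeasurable |m|
    (Filter.Eventually.of_forall fun ω => ?_)
  rw [Real.norm_eq_abs, abs_mul, abs_mul, abs_of_nonneg (ind_nonneg (c ω n)),
    abs_of_nonneg (ind_nonneg (s ω n)), mul_assoc]
  exact mul_le_of_le_one_right (abs_nonneg _)
    (mul_le_one₀ (ind_le_one _) (ind_nonneg _) (ind_le_one _))

theorem IsNetwork.mean_mem_Icc {P : Measure Ω} [IsProbabilityMeasure P] {N : ℕ}
    {ℱ : Filtration ℕ mΩ} {μ : Fin N → ℝ} {X : ℕ → Ω → Fin N → ℝ} {C : ℕ → Ω → LinkVec N}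
    (hNet : IsNetwork P ℱ μ X C) (n : Fin N) : μ n ∈ Set.Icc (0 : ℝ) 1 := by
  rw [← hNet.reward_mean 0 n]
  refine ⟨integral_nonneg fun ω => (hNet.reward_mem 0 ω n).1, ?_⟩
  have hint : Integrable (fun ω => X 0 ω n) P :=
    Integrable.of_bound ((measurable_pi_apply n).comp
      (hNet.measurable_reward 0)).aestronglyMeasurable 1
      (Filter.Eventually.of_forall fun ω => by
        rw [Real.norm_eq_abs, abs_of_nonneg (hNet.reward_mem 0 ω n).1]
        exact (hNet.reward_mem 0 ω n).2)
  simpa using integral_mono hint (integrable_const 1) fun ω => (hNet.reward_mem 0 ω n).2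

theorem measurableSet_largeDeviation {N : ℕ} (μ : Fin N → ℝ) {X : ℕ → Ω → Fin N → ℝ}
    {C S : ℕ → Ω → LinkVec N} (hX : ∀ t, Measurable (X t)) (hC : ∀ t, Measurable (C t))
    (hS : ∀ t, Measurable (S t)) (t : ℕ) (n : Fin N) :
    MeasurableSet {ω | LargeDeviation μ (fun t => X t ω) (fun t => C t ω) (fun t => S t ω) t n} := by
  have hXn : ∀ τ, Measurable fun ω => X τ ω n := fun τ => (measurable_pi_apply n).comp (hX τ)
  have hDn : ∀ τ, Measurable fun ω => ind (C τ ω n) * ind (S τ ω n) := fun τ =>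
    (measurable_ind.comp ((measurable_pi_apply n).comp (hC τ))).mul
      (measurable_ind.comp ((measurable_pi_apply n).comp (hS τ)))
  have hH : Measurable fun ω =>
      (deliveries (fun t => C t ω) (fun t => S t ω) t n : ℝ) := by
    simp_rw [deliveries_eq_sum]
    exact Finset.measurable_fun_sum _ fun τ _ => hDn τ
  have hsum : Measurable fun ω => ∑ τ ∈ Finset.range t,
      (X τ ω n - μ n) * (ind (C τ ω n) * ind (S τ ω n)) :=
    Finset.measurable_fun_sum _ fun τ _ => ((hXn τ).sub_const _).mul (hDn τ)
  simp only [LargeDeviation, ← Nat.cast_pos (α := ℝ)]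
  rw [Set.ofPred_and]
  refine (measurableSet_lt measurable_const hH).inter (measurableSet_lt ?_ ?_)
  · exact hH.mul ((measurable_const.div (hH.const_mul 2)).sqrt)
  · exact continuous_abs.measurable.comp hsum

/-- The delivery indicator of slot `t` is `ℱ t`-measurable and the reward of that slot is
independent of `ℱ t`, so the adaptive Hoeffding bound applies link by link, whatever the dependence
between links. -/
theorem IsNetwork.measureReal_largeDeviation_le {P : Measure Ω} [IsProbabilityMeasure P] {N : ℕ}
    {ℱ : Filtration ℕ mΩ} {μ : Fin N → ℝ} {X : ℕ → Ω → Fin N → ℝ} {C : ℕ → Ω → LinkVec N}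
    (hNet : IsNetwork P ℱ μ X C) {S : ℕ → Ω → LinkVec N} (hS : ∀ t, Measurable[ℱ t] (S t))
    (t : ℕ) (n : Fin N) :
    P.real {ω | LargeDeviation μ (fun t => X t ω) (fun t => C t ω) (fun t => S t ω) t n}
      ≤ 2 * (1 / (t : ℝ) ^ 2) := by
  refine measureReal_abs_sampled_sum_gt_le P ℱ (fun t ω => X t ω n)
    (fun t ω => ind (C t ω n) * ind (S t ω n)) (μ n)
    (fun t => (measurable_pi_apply n).comp (hNet.measurable_reward t))
    (fun t ω => hNet.reward_mem t ω n) (fun t => hNet.reward_mean t n)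
    (fun s t hst => (measurable_pi_apply n).comp (hNet.past_reward_known s t hst))
    (fun t => ?_) (fun t ω => ind_mul_ind_eq_zero_or_one _ _) (fun t => ?_) t
    (fun ω => deliveries (fun t => C t ω) (fun t => S t ω) t n)
    (fun ω => deliveries_eq_sum _ _ _ _)
  · refine indep_of_indep_of_le_left (hNet.reward_indep_info t) ?_
    exact ((measurable_pi_apply n).comp (comap_measurable (X t))).comap_le
  · exact (measurable_ind.comp ((measurable_pi_apply n).comp (hNet.channel_known t))).mul
      (measurable_ind.comp ((measurable_pi_apply n).comp (hS t)))

/-- Twice the Basel sum `π² / 6`; the term at `t = 0` vanishes since `1 / 0 = 0`. -/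
theorem sum_range_two_div_sq_le (T : ℕ) :
    ∑ t ∈ Finset.range T, 2 * (1 / (t : ℝ) ^ 2) ≤ Real.pi ^ 2 / 3 := by
  rw [← Finset.mul_sum]
  have h := sum_le_hasSum (Finset.range T) (fun t _ => by positivity) hasSum_zeta_two
  linarith

end Network

end AgeScheduling

/-! ### The regret bound, by integrating the pathwise estimate. -/

theorem proposition2 {Ω : Type*} [mΩ : MeasurableSpace Ω] (P : Measure Ω) [IsProbabilityMeasure P]
    (N : ℕ) (F : Finset (AgeScheduling.LinkVec N))
    (ℱ : Filtration ℕ mΩ) (μ : Fin N → ℝ)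
    (X : ℕ → Ω → Fin N → ℝ) (C : ℕ → Ω → AgeScheduling.LinkVec N)
    (hNet : AgeScheduling.IsNetwork P ℱ μ X C)
    (Sopt : ℕ → Ω → AgeScheduling.LinkVec N) (hSopt_meas : ∀ t, Measurable (Sopt t))
    (hSopt : ∀ t ω, AgeScheduling.IsMaxWeightSchedule F μ (C t ω) (Sopt t ω))
    (η : ℝ) (hη : 0 < η) (z₀ : Fin N → ℕ) (hz₀ : ∀ n, z₀ n = 0)
    (S : ℕ → Ω → AgeScheduling.LinkVec N) (hS_adapted : ∀ t, Measurable[ℱ t] (S t))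
    (hS : ∀ ω, AgeScheduling.IsLAES F η z₀
      (fun t => X t ω) (fun t => C t ω) (fun t => S t ω))
    (T : ℕ) (hT : 0 < T) :
    AgeScheduling.regret P μ C Sopt S T ≤
      (N : ℝ) * T / η
        + 2 * Real.sqrt (6 * N * (AgeScheduling.maxScheduleSize F : ℝ) * T * Real.log T)
        + N * (1 + 5 * Real.pi ^ 2 / 12) := by
  classical
  have hS_meas : ∀ t, Measurable (S t) := fun t => (hS_adapted t).mono (ℱ.le _) le_rfl
  have hint : ∀ (O : ℕ → Ω → AgeScheduling.LinkVec N), (∀ t, Measurable (O t)) → ∀ t n,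
      Integrable (fun ω => μ n * AgeScheduling.ind (C t ω n) * AgeScheduling.ind (O t ω n)) P :=
    fun O hO t n =>
      AgeScheduling.integrable_mul_ind_mul_ind P (hNet.measurable_channel t) (hO t) (μ n) n
  have hμ := hNet.mean_mem_Icc
  set B : ℕ → Fin N → Set Ω := fun t n => {ω | AgeScheduling.LargeDeviation μ
    (fun t => X t ω) (fun t => C t ω) (fun t => S t ω) t n} with hB
  have hBmeas : ∀ t n, MeasurableSet (B t n) := fun t n =>
    AgeScheduling.measurableSet_largeDeviation μ hNet.measurable_reward hNet.measurable_channel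
      hS_meas t n
  have hBint : ∀ t n, Integrable ((B t n).indicator (1 : Ω → ℝ)) P := fun t n =>
    (integrable_const (1 : ℝ)).indicator (hBmeas t n)
  set K : ℝ := (N : ℝ) * T / η
    + 2 * Real.sqrt (6 * N * (AgeScheduling.maxScheduleSize F : ℝ) * T * Real.log T) + N with hK
  have hreg : AgeScheduling.regret P μ C Sopt S T
      = ∫ ω, ∑ t ∈ Finset.range T, ∑ n,
        (μ n * AgeScheduling.ind (C t ω n) * AgeScheduling.ind (Sopt t ω n)
          - μ n * AgeScheduling.ind (C t ω n) * AgeScheduling.ind (S t ω n)) ∂P := by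
    rw [AgeScheduling.regret]
    refine Eq.symm ((integral_finsetSum _ fun t _ => integrable_finsetSum _ fun n _ =>
      (hint Sopt hSopt_meas t n).sub (hint S hS_meas t n)).trans ?_)
    refine Finset.sum_congr rfl fun t _ => ?_
    refine (integral_finsetSum _ fun n _ =>
      (hint Sopt hSopt_meas t n).sub (hint S hS_meas t n)).trans ?_
    exact Finset.sum_congr rfl fun n _ =>
      integral_sub (hint Sopt hSopt_meas t n) (hint S hS_meas t n)
  have hsumint : Integrable
      (fun ω => ∑ t ∈ Finset.range T, ∑ n, (B t n).indicator (1 : Ω → ℝ) ω) P :=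
    integrable_finsetSum _ fun t _ => integrable_finsetSum _ fun n _ => hBint t n
  have hmono : AgeScheduling.regret P μ C Sopt S T
      ≤ ∫ ω, (K + ∑ t ∈ Finset.range T, ∑ n, (B t n).indicator (1 : Ω → ℝ) ω) ∂P := by
    rw [hreg]
    refine integral_mono (integrable_finsetSum _ fun t _ => integrable_finsetSum _ fun n _ =>
      (hint Sopt hSopt_meas t n).sub (hint S hS_meas t n))
      ((integrable_const K).add hsumint) fun ω => ?_
    have h := AgeScheduling.path_regret_le F μ hμ hη z₀ hz₀ (fun t => X t ω)
      (fun t n => hNet.reward_mem t ω n) (fun t => C t ω) (fun t => S t ω)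
      (fun t => Sopt t ω) (hS ω) (fun t => (hSopt t ω).1) T
    simpa only [hB, Set.indicator_apply, Set.mem_ofPred_eq, Pi.one_apply] using h
  have hbad : ∫ ω, ∑ t ∈ Finset.range T, ∑ n, (B t n).indicator (1 : Ω → ℝ) ω ∂P
      ≤ N * (Real.pi ^ 2 / 3) := by
    rw [integral_finsetSum _ fun t _ => integrable_finsetSum _ fun n _ => hBint t n]
    calc ∑ t ∈ Finset.range T, ∫ ω, ∑ n, (B t n).indicator (1 : Ω → ℝ) ω ∂P
        ≤ ∑ t ∈ Finset.range T, N * (2 * (1 / (t : ℝ) ^ 2)) := by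
          refine Finset.sum_le_sum fun t _ => ?_
          rw [integral_finsetSum _ fun n _ => hBint t n]
          simp_rw [integral_indicator_one (hBmeas t _)]
          refine (Finset.sum_le_sum fun n _ =>
            hNet.measureReal_largeDeviation_le hS_adapted t n).trans_eq ?_
          simp
      _ ≤ N * (Real.pi ^ 2 / 3) := by
          rw [← Finset.mul_sum]
          gcongr
          exact AgeScheduling.sum_range_two_div_sq_le T
  rw [integral_add (integrable_const K) hsumint, integral_const, probReal_univ, one_smul] at hmono
  -- The argument yields `4π² / 12`, slightly better than the stated `5π² / 12`.
  have hpi : (N : ℝ) * (Real.pi ^ 2 / 3) ≤ N * (5 * Real.pi ^ 2 / 12) := by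
    refine mul_le_mul_of_nonneg_left ?_ (Nat.cast_nonneg N)
    linarith [sq_nonneg Real.pi]
  have hN : (N : ℝ) * (1 + 5 * Real.pi ^ 2 / 12) = N + N * (5 * Real.pi ^ 2 / 12) := by ring
  rw [hN]
  linarith
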